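/- Let $k \ge 3$, $g \ge 3$ and $\varepsilon$ be integers with $g$ odd and $0 < \varepsilon \le \frac{k-1}{2}$. Then for no integer $n$ does there exist a $\mathrm{vgr}\bigl(n,k,g,\tfrac{k(k-1)^{\lfloor g/2\rfloor}}{2}-\varepsilon\bigr)$-graph. Here, for integers $n,k,g,\lambda$, a $\mathrm{vgr}(n,k,g,\lambda)$-graph is a finite simple $k$-regular graph of girth $g$ on $n$ vertices in which every vertex is contained in exactly $\lambda$ cycles of length $g$. -/

import Mathlib

namespace VertexGirthRegular

/-- The set of cycles of length `g` of the graph `G` that contain the vertex `v`. A cycle is a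
subgraph (the subgraph traced by some closed walk that is a cycle), so neither its starting point
nor its direction is counted. -/
def cyclesThrough {V : Type*} (G : SimpleGraph V) (g : ℕ) (v : V) : Set G.Subgraph :=
  {C | v ∈ C.verts ∧ ∃ (u : V) (p : G.Walk u u), p.IsCycle ∧ p.length = g ∧ p.toSubgraph = C}

/-- `G` is a `vgr(n, k, g, lam)`-graph: a `k`-regular graph of girth `g` on `n` vertices such that
every vertex is contained in exactly `lam` cycles of length `g`. -/
structure IsVGR {V : Type*} [Fintype V] (G : SimpleGraph V) [DecidableRel G.Adj]
    (n k g lam : ℕ) : Prop where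
  card_eq : Fintype.card V = n
  regular : G.IsRegularOfDegree k
  girth_eq : G.egirth = (g : ℕ∞)
  ncard_cycles : ∀ v : V, (cyclesThrough G g v).ncard = lam

end VertexGirthRegular

/-! Write `g = 2d + 1`. Up to radius `d` the graph looks like a tree from every vertex `v`, so a
girth cycle through `v` is determined by its opposite edge, which joins two vertices at distance `d`
from `v`; every such edge occurs (`ncard_cyclesThrough`). Counting the `k(k-1)^d` edge ends that
point away from `v` at the sphere of radius `d` shows that exactly `k(k-1)^d - 2λ = 2ε` edges leave
the ball of radius `d` around any vertex (`two_mul_ncard_add_boundaryCard`).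

As `2ε > 0`, some edge leaves the ball around `x`, and there is a neighbour `y` of `x` whose ball is
different. By posimodularity, the boundaries of the two differences of these balls total at most
`4ε`. Each difference is nonempty and each of its vertices has a neighbour outside it, which forces
at least `k` boundary edges (`le_boundaryCard`). Hence `2k ≤ 4ε ≤ 2(k-1)`, a contradiction. -/

namespace VertexGirthRegular

open SimpleGraph

/-! ### Uniqueness of short paths below the girth -/

section Paths

variable {V : Type*} {G : SimpleGraph V}

/-- Two paths with the same ends whose lengths add up to less than the girth coincide. -/
theorem eq_of_isPath_of_length_add_lt_egirth {u v : V} {p q : G.Walk u v} (hp : p.IsPath)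
    (hq : q.IsPath) (h : ((p.length + q.length : ℕ) : ℕ∞) < G.egirth) : p = q := by
  classical
  by_contra hne
  -- Two distinct paths with the same ends force a cycle in the union of their edges, and that cycle
  -- has at most `p.length + q.length` edges.
  set H : SimpleGraph V := fromEdgeSet {e | e ∈ p.edges ++ q.edges} with hH
  have hHG : H ≤ G := by
    intro a b hab
    rw [hH, fromEdgeSet_adj] at hab
    rcases List.mem_append.1 hab.1 with h1 | h1
    · exact p.adj_of_mem_edges h1
    · exact q.adj_of_mem_edges h1
  have hmem : ∀ e ∈ G.edgeSet, e ∈ p.edges ++ q.edges → e ∈ H.edgeSet := by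
    intro e he h1
    rw [hH, edgeSet_fromEdgeSet]
    exact ⟨h1, G.not_isDiag_of_mem_edgeSet he⟩
  have hpH : ∀ e ∈ p.edges, e ∈ H.edgeSet := fun e he =>
    hmem e (p.edges_subset_edgeSet he) (List.mem_append_left _ he)
  have hqH : ∀ e ∈ q.edges, e ∈ H.edgeSet := fun e he =>
    hmem e (q.edges_subset_edgeSet he) (List.mem_append_right _ he)
  have hac : ¬ H.IsAcyclic := by
    intro hac
    have h1 := (hac.subsingleton_path u v).elim ⟨p.transfer H hpH, hp.transfer hpH⟩
      ⟨q.transfer H hqH, hq.transfer hqH⟩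
    have h2 : (p.transfer H hpH).support = (q.transfer H hqH).support :=
      congrArg (fun r : H.Path u v => (r : H.Walk u v).support) h1
    rw [Walk.support_transfer, Walk.support_transfer] at h2
    exact hne (Walk.support_injective h2)
  obtain ⟨a, c, hc, -⟩ := exists_egirth_eq_length.2 hac
  have h1 : G.egirth ≤ (c.mapLe hHG).length := egirth_le_length (hc.mapLe hHG)
  have h2 : c.edges ⊆ p.edges ++ q.edges := by
    intro e he
    have h3 := c.edges_subset_edgeSet he
    rw [hH, edgeSet_fromEdgeSet] at h3
    exact h3.1
  have h3 := (List.subperm_of_subset hc.edges_nodup h2).length_le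
  rw [List.length_append, Walk.length_edges, Walk.length_edges, Walk.length_edges] at h3
  rw [Walk.length_map] at h1
  exact absurd (h1.trans (by exact_mod_cast h3)) (not_le.2 h)

theorem isPath_of_edist_eq_length {u v : V} {p : G.Walk u v} (h : G.edist u v = p.length) :
    p.IsPath := by
  apply p.isPath_of_length_eq_dist
  rw [SimpleGraph.dist, h]; simp

theorem exists_isPath_of_edist_eq {u v : V} {n : ℕ} (h : G.edist u v = n) :
    ∃ p : G.Walk u v, p.IsPath ∧ p.length = n := by
  obtain ⟨p, hp⟩ := exists_walk_of_edist_eq_coe h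
  exact ⟨p, isPath_of_edist_eq_length (by rw [h, hp]), hp⟩

theorem eq_end_of_mem_support_of_edist_eq {u v x : V} {p : G.Walk u v} (hx : x ∈ p.support)
    (h : (p.length : ℕ∞) ≤ G.edist u x) : x = v := by
  classical
  by_contra hne
  have h1 := Walk.length_takeUntil_lt_length hx hne
  have h2 := h.trans (p.takeUntil x hx).edist_le
  exact absurd (by exact_mod_cast h2) (not_le.2 h1)

theorem edist_le_add_one_of_adj (v : V) {y z : V} (h : G.Adj y z) :
    G.edist v z ≤ G.edist v y + 1 := by
  have := G.edist_triangle (u := v) (v := y) (w := z)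
  rwa [edist_eq_one_iff_adj.2 h] at this

/-- A vertex on a path no longer than half the girth is as far as the path tells. -/
theorem edist_eq_length_of_isPath {u v : V} {p : G.Walk u v} (hp : p.IsPath)
    (h : ((p.length + p.length : ℕ) : ℕ∞) < G.egirth) : G.edist u v = p.length := by
  have hle := p.edist_le
  obtain ⟨m, hm⟩ := ENat.ne_top_iff_exists.1 (ne_top_of_le_ne_top (ENat.natCast_ne_top _) hle)
  obtain ⟨q, hq, hql⟩ := exists_isPath_of_edist_eq hm.symm
  rw [← hm] at hle
  have hle' : m ≤ p.length := by exact_mod_cast hle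
  have : p = q := eq_of_isPath_of_length_add_lt_egirth hp hq
    (lt_of_le_of_lt (by rw [hql]; exact_mod_cast (by omega)) h)
  rw [← hm, this, hql]

variable {d : ℕ}

theorem parent_unique (hG : ((2 * d + 1 : ℕ) : ℕ∞) ≤ G.egirth) {v y a b : V} {j : ℕ} (hj : j < d)
    (hy : G.edist v y = (j + 1 : ℕ)) (ha : G.edist v a = j) (hb : G.edist v b = j)
    (hay : G.Adj a y) (hby : G.Adj b y) : a = b := by
  obtain ⟨p, -, hpl⟩ := exists_isPath_of_edist_eq ha
  obtain ⟨q, -, hql⟩ := exists_isPath_of_edist_eq hb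
  have h1 : (p.concat hay).IsPath := isPath_of_edist_eq_length (by rw [hy, Walk.length_concat, hpl])
  have h2 : (q.concat hby).IsPath := isPath_of_edist_eq_length (by rw [hy, Walk.length_concat, hql])
  have h3 := eq_of_isPath_of_length_add_lt_egirth h1 h2 (lt_of_lt_of_le
    (by rw [Walk.length_concat, Walk.length_concat, hpl, hql]; exact_mod_cast (by omega)) hG)
  simpa using congrArg Walk.penultimate h3

/-- Otherwise a geodesic to `y` extended by the edge and a geodesic to `z` would be two short paths
of different lengths. This fails at `j = d`, where girth cycles close up. -/
theorem not_adj_of_edist_eq (hG : ((2 * d + 1 : ℕ) : ℕ∞) ≤ G.egirth) {v y z : V} {j : ℕ}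
    (hj : j < d) (hy : G.edist v y = j) (hz : G.edist v z = j) : ¬ G.Adj y z := by
  intro hyz
  obtain ⟨p, hp, hpl⟩ := exists_isPath_of_edist_eq hy
  obtain ⟨q, hq, hql⟩ := exists_isPath_of_edist_eq hz
  have hzp : z ∉ p.support := fun hmem =>
    hyz.ne (eq_end_of_mem_support_of_edist_eq hmem (by rw [hz, hpl])).symm
  have h3 := eq_of_isPath_of_length_add_lt_egirth (hp.concat hzp hyz) hq (lt_of_lt_of_le
    (by rw [Walk.length_concat, hpl, hql]; exact_mod_cast (by omega)) hG)
  have := congrArg Walk.length h3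
  rw [Walk.length_concat] at this
  omega

end Paths

/-! ### Girth cycles and their opposite edges -/

section Cycles

variable {V : Type*} {G : SimpleGraph V} {d : ℕ}

/-- The graph of the edges of `G` joining two vertices at distance `d` from `v`. -/
def sphereGraph (G : SimpleGraph V) (d : ℕ) (v : V) : SimpleGraph V where
  Adj a b := G.Adj a b ∧ G.edist v a = d ∧ G.edist v b = d
  symm := ⟨fun _ _ h => ⟨h.1.symm, h.2.2, h.2.1⟩⟩
  loopless := ⟨fun _ h => h.1.ne rfl⟩

theorem exists_decomposition_of_mem_cyclesThrough (hd : 0 < d) {v : V} {C : G.Subgraph}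
    (hC : C ∈ cyclesThrough G (2 * d + 1) v) :
    ∃ (y z : V) (h : G.Adj y z) (a : G.Walk v y) (b : G.Walk v z), a.IsPath ∧ b.IsPath ∧
      a.length = d ∧ b.length = d ∧ C = a.toSubgraph ⊔ (G.subgraphOfAdj h ⊔ b.toSubgraph) := by
  classical
  obtain ⟨hv, u, p, hp, hpl, rfl⟩ := hC
  rw [Walk.mem_verts_toSubgraph] at hv
  have hc := hp.rotate hv
  have hcl : (p.rotate v hv).length = 2 * d + 1 := by rw [Walk.length_rotate, hpl]
  rw [← Walk.toSubgraph_rotate p hv]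
  generalize p.rotate v hv = c at hc hcl
  have ha := hc.isPath_take (n := d) (by omega)
  have hal : (c.take d).length = d := by rw [Walk.take_length]; omega
  have hr := hc.isPath_drop hd
  have hrl : (c.drop d).length = d + 1 := by rw [Walk.drop_length]; omega
  have hcs : c.toSubgraph = (c.take d).toSubgraph ⊔ (c.drop d).toSubgraph := by
    rw [← Walk.toSubgraph_append, Walk.append_take_drop_eq]
  rw [hcs]
  generalize c.take d = a at ha hal ⊢
  generalize c.drop d = r at hr hrl ⊢
  generalize c.getVert d = y at a r ha hal hr hrl ⊢
  cases r with
  | nil => simp at hrl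
  | cons h b =>
    refine ⟨_, _, h, a, b.reverse, ha, hr.of_cons.reverse, hal, ?_, ?_⟩
    · rw [Walk.length_reverse]; simpa using hrl
    · rw [Walk.toSubgraph_reverse]; rfl

/-- A walk of length `d` from `v` can meet the sphere of radius `d` only at its last vertex. -/
theorem notMem_edges_of_mem_sphereGraph {v y : V} {a : G.Walk v y} (ha : a.length = d)
    {e : Sym2 V} (he : e ∈ (sphereGraph G d v).edgeSet) : e ∉ a.edges := by
  induction e with
  | _ s t =>
    intro hst
    obtain ⟨h1, h2, h3⟩ := he
    have hs := eq_end_of_mem_support_of_edist_eq (a.fst_mem_support_of_mem_edges hst)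
      (by rw [h2, ha])
    have ht := eq_end_of_mem_support_of_edist_eq (a.snd_mem_support_of_mem_edges hst)
      (by rw [h3, ha])
    exact h1.ne (hs.trans ht.symm)

theorem two_mul_lt_egirth (hG : ((2 * d + 1 : ℕ) : ℕ∞) ≤ G.egirth) {v y z : V} {a : G.Walk v y}
    {b : G.Walk v z} (ha : a.length = d) (hb : b.length = d) :
    ((a.length + b.length : ℕ) : ℕ∞) < G.egirth :=
  lt_of_lt_of_le (by rw [ha, hb]; exact_mod_cast (by omega)) hG

/-- The edge of a girth cycle that is opposite to `v`. -/
theorem existsUnique_edge_of_mem_cyclesThrough (hG : ((2 * d + 1 : ℕ) : ℕ∞) ≤ G.egirth)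
    (hd : 0 < d) {v : V} {C : G.Subgraph} (hC : C ∈ cyclesThrough G (2 * d + 1) v) :
    ∃! e, e ∈ (sphereGraph G d v).edgeSet ∧ e ∈ C.edgeSet := by
  obtain ⟨y, z, h, a, b, ha, hb, hal, hbl, rfl⟩ := exists_decomposition_of_mem_cyclesThrough hd hC
  refine ⟨s(y, z), ⟨⟨h, ?_, ?_⟩, ?_⟩, ?_⟩
  · rw [edist_eq_length_of_isPath ha (two_mul_lt_egirth hG hal hal), hal]
  · rw [edist_eq_length_of_isPath hb (two_mul_lt_egirth hG hbl hbl), hbl]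
  · simp
  · rintro e ⟨he, heC⟩
    simp only [Subgraph.edgeSet_sup, Set.mem_union, Walk.mem_edges_toSubgraph,
      edgeSet_subgraphOfAdj, Set.mem_singleton_iff] at heC
    rcases heC with h1 | h1 | h1
    · exact absurd h1 (notMem_edges_of_mem_sphereGraph hal he)
    · exact h1
    · exact absurd h1 (notMem_edges_of_mem_sphereGraph hbl he)

/-- The common opposite edge fixes the ends of the two arms of length `d`, up to a swap, and short
paths are determined by their ends. -/
theorem eq_of_mem_cyclesThrough_of_mem_edgeSet (hG : ((2 * d + 1 : ℕ) : ℕ∞) ≤ G.egirth)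
    (hd : 0 < d) {v : V} {C C' : G.Subgraph} (hC : C ∈ cyclesThrough G (2 * d + 1) v)
    (hC' : C' ∈ cyclesThrough G (2 * d + 1) v) {e : Sym2 V}
    (he : e ∈ (sphereGraph G d v).edgeSet) (heC : e ∈ C.edgeSet) (heC' : e ∈ C'.edgeSet) :
    C = C' := by
  obtain ⟨y, z, h, a, b, ha, hb, hal, hbl, rfl⟩ := exists_decomposition_of_mem_cyclesThrough hd hC
  obtain ⟨y', z', h', a', b', ha', hb', hal', hbl', rfl⟩ :=
    exists_decomposition_of_mem_cyclesThrough hd hC'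
  simp only [Subgraph.edgeSet_sup, Set.mem_union, Walk.mem_edges_toSubgraph,
    edgeSet_subgraphOfAdj, Set.mem_singleton_iff, notMem_edges_of_mem_sphereGraph hal he,
    notMem_edges_of_mem_sphereGraph hbl he, notMem_edges_of_mem_sphereGraph hal' he,
    notMem_edges_of_mem_sphereGraph hbl' he, false_or, or_false] at heC heC'
  rcases Sym2.eq_iff.1 (heC.symm.trans heC') with ⟨rfl, rfl⟩ | ⟨rfl, rfl⟩
  · obtain rfl := eq_of_isPath_of_length_add_lt_egirth ha ha' (two_mul_lt_egirth hG hal hal')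
    obtain rfl := eq_of_isPath_of_length_add_lt_egirth hb hb' (two_mul_lt_egirth hG hbl hbl')
    rfl
  · obtain rfl := eq_of_isPath_of_length_add_lt_egirth ha hb' (two_mul_lt_egirth hG hal hbl')
    obtain rfl := eq_of_isPath_of_length_add_lt_egirth hb ha' (two_mul_lt_egirth hG hbl hal')
    rw [subgraphOfAdj_symm h, ← sup_assoc, ← sup_assoc, sup_comm (a.toSubgraph ⊔ _),
      sup_comm a.toSubgraph, ← sup_assoc]

theorem exists_mem_cyclesThrough (hG : ((2 * d + 1 : ℕ) : ℕ∞) ≤ G.egirth) {v : V} {e : Sym2 V}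
    (he : e ∈ (sphereGraph G d v).edgeSet) :
    ∃ C ∈ cyclesThrough G (2 * d + 1) v, e ∈ C.edgeSet := by
  induction e with
  | _ y z =>
    obtain ⟨hyz, hy, hz⟩ := he
    obtain ⟨a, ha, hal⟩ := exists_isPath_of_edist_eq hy
    obtain ⟨b, hb, hbl⟩ := exists_isPath_of_edist_eq hz
    have hza : z ∉ a.support := fun hmem =>
      hyz.ne (eq_end_of_mem_support_of_edist_eq hmem (by rw [hz, hal])).symm
    have hp := ha.concat hza hyz
    have hd : 0 < d := by
      rcases Nat.eq_zero_or_pos d with rfl | hd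
      · simp only [Nat.cast_zero, edist_eq_zero_iff] at hy hz
        exact absurd (hy.symm.trans hz) hyz.ne
      · exact hd
    -- If the arms met at `x ≠ v`, their parts up to `x` would coincide; the remainders, one
    -- extended by the edge `yz`, would then also be equal short paths, although their lengths
    -- differ by one.
    have hdisj : (a.concat hyz).support.tail.Disjoint b.reverse.support.tail := by
      have hnd := hp.support_nodup
      have hnd' := hb.reverse.support_nodup
      rw [← Walk.cons_tail_support, List.nodup_cons] at hnd hnd'
      intro x hxa hxb
      have hxv : v ≠ x := fun h => hnd.1 (h ▸ hxa)
      have hxz : x ≠ z := fun h => hnd'.1 (h ▸ hxb)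
      have hxa' : x ∈ a.support := by
        have := List.mem_of_mem_tail hxa
        rw [Walk.support_concat, List.mem_append, List.mem_singleton] at this
        exact this.resolve_right hxz
      have hxb' : x ∈ b.support := by simpa using List.mem_of_mem_tail hxb
      obtain ⟨a₁, a₂, ha₁, ha₂, rfl⟩ := ha.mem_support_iff_exists_append.1 hxa'
      obtain ⟨b₁, b₂, hb₁, hb₂, rfl⟩ := hb.mem_support_iff_exists_append.1 hxb'
      rw [Walk.length_append] at hal hbl
      have h1 := eq_of_isPath_of_length_add_lt_egirth ha₁ hb₁
        (lt_of_lt_of_le (by exact_mod_cast (by omega)) hG)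
      have hpos : 0 < a₁.length := by
        rw [Nat.pos_iff_ne_zero]
        exact fun h0 => hxv (Walk.eq_of_length_eq_zero h0)
      have hza₂ : z ∉ a₂.support := fun h => hza (by simp [h])
      have h2 := eq_of_isPath_of_length_add_lt_egirth (ha₂.concat hza₂ hyz) hb₂
        (lt_of_lt_of_le (by rw [Walk.length_concat, ← h1] at *; exact_mod_cast (by omega)) hG)
      have h3 := congrArg Walk.length h2
      have h4 := congrArg Walk.length h1
      rw [Walk.length_concat] at h3
      omega
    have hcyc : ((a.concat hyz).append b.reverse).IsCycle :=
      hp.isCycle_append hb.reverse hdisj (Or.inl (by rw [Walk.length_concat]; omega))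
    refine ⟨_, ⟨?_, v, _, hcyc, ?_, rfl⟩, ?_⟩
    · simp
    · rw [Walk.length_append, Walk.length_concat, Walk.length_reverse]; omega
    · simp

/-- The girth cycles through `v` correspond to the edges inside the sphere of radius `d`. -/
theorem ncard_cyclesThrough (hG : ((2 * d + 1 : ℕ) : ℕ∞) ≤ G.egirth) (hd : 0 < d) (v : V) :
    (cyclesThrough G (2 * d + 1) v).ncard = (sphereGraph G d v).edgeSet.ncard := by
  choose f hf hfu using fun C (hC : C ∈ cyclesThrough G (2 * d + 1) v) =>
    existsUnique_edge_of_mem_cyclesThrough hG hd hC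
  refine Set.ncard_congr f (fun C hC => (hf C hC).1) ?_ ?_
  · intro C C' hC hC' h
    exact eq_of_mem_cyclesThrough_of_mem_edgeSet hG hd hC hC' (hf C hC).1 (hf C hC).2
      (h ▸ (hf C' hC').2)
  · intro e he
    obtain ⟨C, hC, heC⟩ := exists_mem_cyclesThrough hG he
    exact ⟨C, hC, (hfu C hC e ⟨he, heC⟩).symm⟩

end Cycles

/-! ### Edge boundaries, spheres and balls -/

open Finset

open scoped Classical in
/-- The number of edges leaving the vertex set `X`. -/
noncomputable def boundaryCard {V : Type*} [Fintype V] (G : SimpleGraph V) (X : Finset V) : ℕ :=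
  ∑ a ∈ X, #{b | G.Adj a b ∧ b ∉ X}

open scoped Classical in
/-- The vertices at distance `j` from `v`. -/
noncomputable def sphere {V : Type*} [Fintype V] (G : SimpleGraph V) (j : ℕ) (v : V) : Finset V :=
  {y | G.edist v y = j}

open scoped Classical in
/-- The vertices at distance at most `j` from `v`. -/
noncomputable def closedBall {V : Type*} [Fintype V] (G : SimpleGraph V) (j : ℕ) (v : V) :
    Finset V :=
  {y | G.edist v y ≤ j}

section Levels

variable {V : Type*} {G : SimpleGraph V}

/-- The end of an edge is at most one level away from its start. -/
theorem edist_of_adj {v y z : V} {j : ℕ} (hy : G.edist v y = (j + 1 : ℕ)) (h : G.Adj y z) :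
    G.edist v z = j ∨ G.edist v z = (j + 1 : ℕ) ∨ G.edist v z = (j + 2 : ℕ) := by
  have h1 := edist_le_add_one_of_adj v h
  have h2 := edist_le_add_one_of_adj v h.symm
  rw [hy] at h1 h2
  obtain ⟨m, hm⟩ := ENat.ne_top_iff_exists.1
    (ne_top_of_le_ne_top (ENat.natCast_ne_top (j + 1 + 1)) (by exact_mod_cast h1))
  rw [← hm] at h1 h2 ⊢
  norm_cast at h1 h2 ⊢
  omega

theorem exists_parent {v y : V} {j : ℕ} (hy : G.edist v y = (j + 1 : ℕ)) :
    ∃ a, G.Adj y a ∧ G.edist v a = j := by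
  obtain ⟨p, hp⟩ := exists_walk_of_edist_eq_coe hy
  have hn : ¬ p.Nil := by rw [← Walk.length_eq_zero_iff]; omega
  refine ⟨p.penultimate, (p.adj_penultimate hn).symm, ?_⟩
  have h1 := p.dropLast.edist_le
  rw [Walk.length_dropLast, hp] at h1
  have h2 := edist_le_add_one_of_adj v (p.adj_penultimate hn)
  rw [hy] at h2
  obtain ⟨m, hm⟩ := ENat.ne_top_iff_exists.1 (ne_top_of_le_ne_top (ENat.natCast_ne_top _) h1)
  rw [← hm] at h1 h2 ⊢
  norm_cast at h1 h2 ⊢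
  omega

end Levels

section Boundary

variable {V : Type*} [Fintype V] {G : SimpleGraph V}

open scoped Classical in
theorem boundaryCard_eq_sum (X : Finset V) :
    boundaryCard G X = ∑ a, ∑ b, if G.Adj a b ∧ a ∈ X ∧ b ∉ X then 1 else 0 := by
  rw [boundaryCard, ← Finset.sum_filter_add_sum_filter_not univ (· ∈ X)]
  rw [Finset.sum_eq_zero (s := filter (fun a => ¬ a ∈ X) univ), add_zero]
  · refine Finset.sum_congr (by ext; simp) fun a ha => ?_
    rw [Finset.card_filter]
    exact Finset.sum_congr rfl fun b _ => if_congr (by simp [(Finset.mem_filter.1 ha).2]) rfl rfl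
  · intro a ha
    exact Finset.sum_eq_zero fun b _ => if_neg fun h => (Finset.mem_filter.1 ha).2 h.2.1

open scoped Classical in
/-- Posimodularity of the edge boundary. -/
theorem boundaryCard_sdiff_add_le (A B : Finset V) :
    boundaryCard G (A \ B) + boundaryCard G (B \ A) ≤ boundaryCard G A + boundaryCard G B := by
  -- Doubling counts ordered adjacent pairs separated by `X`, a symmetric form in which
  -- posimodularity holds pair by pair.
  have key : ∀ X : Finset V, boundaryCard G X + boundaryCard G X =
      ∑ a, ∑ b, if G.Adj a b ∧ ¬ (a ∈ X ↔ b ∈ X) then 1 else 0 := by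
    intro X
    have h1 := boundaryCard_eq_sum (G := G) X
    rw [congrArg₂ (· + ·) h1 (h1.trans Finset.sum_comm), ← Finset.sum_add_distrib]
    refine Finset.sum_congr rfl fun a _ => ?_
    rw [← Finset.sum_add_distrib]
    refine Finset.sum_congr rfl fun b _ => ?_
    rw [G.adj_comm b a]
    by_cases h : G.Adj a b <;> by_cases ha : a ∈ X <;> by_cases hb : b ∈ X <;>
      simp [h, ha, hb]
  suffices h : (boundaryCard G (A \ B) + boundaryCard G (A \ B)) +
      (boundaryCard G (B \ A) + boundaryCard G (B \ A)) ≤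
      (boundaryCard G A + boundaryCard G A) + (boundaryCard G B + boundaryCard G B) by omega
  rw [key, key, key, key, ← Finset.sum_add_distrib, ← Finset.sum_add_distrib]
  refine Finset.sum_le_sum fun a _ => ?_
  rw [← Finset.sum_add_distrib, ← Finset.sum_add_distrib]
  refine Finset.sum_le_sum fun b _ => ?_
  by_cases h : G.Adj a b <;> by_cases ha : a ∈ A <;> by_cases hb : b ∈ A <;>
    by_cases ha' : a ∈ B <;> by_cases hb' : b ∈ B <;> simp [h, ha, hb, ha', hb']

open scoped Classical in
theorem card_le_boundaryCard {D : Finset V} (h : ∀ z ∈ D, ∃ b, G.Adj z b ∧ b ∉ D) :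
    #D ≤ boundaryCard G D := by
  rw [boundaryCard, Finset.card_eq_sum_ones]
  refine Finset.sum_le_sum fun a ha => Finset.card_pos.2 ?_
  obtain ⟨b, hb⟩ := h a ha
  exact ⟨b, by simpa using hb⟩

open scoped Classical in
-- A vertex of `D` has at most `#D - 1` neighbours in `D`, hence at least `k + 1 - #D` outside.
theorem card_mul_le_boundaryCard {k : ℕ} (hk : ∀ v, #{b | G.Adj v b} = k)
    (D : Finset V) : #D * (k + 1 - #D) ≤ boundaryCard G D := by
  rw [boundaryCard, ← smul_eq_mul, ← Finset.sum_const]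
  refine Finset.sum_le_sum fun a ha => ?_
  have h1 := Finset.card_filter_add_card_filter_not (s := {b | G.Adj a b}) (· ∈ D)
  rw [hk a, Finset.filter_filter, Finset.filter_filter] at h1
  have h2 : #{b | G.Adj a b ∧ b ∈ D} ≤ #(D.erase a) := by
    refine Finset.card_le_card fun b hb => ?_
    have hb := (Finset.mem_filter.1 hb).2
    exact Finset.mem_erase.2 ⟨hb.1.ne', hb.2⟩
  rw [Finset.card_erase_of_mem ha] at h2
  have h3 : 0 < #D := Finset.card_pos.2 ⟨a, ha⟩
  omega

open scoped Classical in
-- Large sets have `#D ≥ k` boundary edges by the hypothesis on neighbours; for `1 ≤ #D ≤ k` the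
-- concave bound `#D * (k + 1 - #D)` is at least `k`.
theorem le_boundaryCard {k : ℕ} (hk : ∀ v, #{b | G.Adj v b} = k)
    {D : Finset V} (hD : D.Nonempty) (h : ∀ z ∈ D, ∃ b, G.Adj z b ∧ b ∉ D) :
    k ≤ boundaryCard G D := by
  have h1 := card_le_boundaryCard h
  have h2 := card_mul_le_boundaryCard hk D
  have h3 : 1 ≤ #D := Finset.card_pos.2 hD
  by_contra hlt
  obtain ⟨m, hm⟩ := Nat.exists_eq_add_of_le h3
  obtain ⟨l, hl⟩ := Nat.exists_eq_add_of_le (show #D ≤ k by omega)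
  rw [show k + 1 - #D = l + 1 by omega, hm] at h2
  -- With `#D = 1 + m` and `k = 1 + m + l`, the product is `(1 + m)(1 + l) = k + ml`.
  nlinarith [Nat.zero_le (m * l)]

end Boundary

/-! ### Counting by distance levels -/

section Layers

variable {V : Type*} [Fintype V] {G : SimpleGraph V} {d k : ℕ}

theorem mem_sphere {j : ℕ} {v y : V} : y ∈ sphere G j v ↔ G.edist v y = j := by
  simp [sphere]

theorem mem_closedBall {j : ℕ} {v y : V} : y ∈ closedBall G j v ↔ G.edist v y ≤ j := by
  simp [closedBall]

open scoped Classical in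
theorem card_neighbors_sphere_pred (hG : ((2 * d + 1 : ℕ) : ℕ∞) ≤ G.egirth) {v y : V} {j : ℕ}
    (hj : j < d) (hy : G.edist v y = (j + 1 : ℕ)) : #{b ∈ sphere G j v | G.Adj y b} = 1 := by
  obtain ⟨a, ha, hva⟩ := exists_parent hy
  rw [Finset.card_eq_one]
  refine ⟨a, ?_⟩
  ext b
  rw [Finset.mem_filter, mem_sphere, Finset.mem_singleton]
  constructor
  · rintro ⟨h1, h2⟩
    exact parent_unique hG hj hy h1 hva h2.symm ha.symm
  · rintro rfl
    exact ⟨hva, ha⟩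

open scoped Classical in
theorem card_neighbors_add (hk : ∀ v, #{b | G.Adj v b} = k) {v y : V} {j : ℕ}
    (hy : G.edist v y = (j + 1 : ℕ)) :
    #{b ∈ sphere G j v | G.Adj y b} + #{b ∈ sphere G (j + 1) v | G.Adj y b} +
      #{b ∈ sphere G (j + 2) v | G.Adj y b} = k := by
  rw [← hk y, ← Finset.card_union_of_disjoint,
    ← Finset.card_union_of_disjoint]
  · congr 1
    ext b
    simp only [Finset.mem_union, Finset.mem_filter, mem_sphere, Finset.mem_univ, true_and]
    constructor
    · tauto
    · intro h
      have := edist_of_adj hy h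
      tauto
  · rw [Finset.disjoint_left]
    intro b h1 h2
    simp only [Finset.mem_union, Finset.mem_filter, mem_sphere] at h1 h2
    rcases h1 with h1 | h1 <;>
    · have := h1.1.symm.trans h2.1
      norm_cast at this
      omega
  · rw [Finset.disjoint_left]
    intro b h1 h2
    simp only [Finset.mem_filter, mem_sphere] at h1 h2
    have := h1.1.symm.trans h2.1
    norm_cast at this
    omega

open scoped Classical in
theorem card_sphere (hk : ∀ v, #{b | G.Adj v b} = k)
    (hG : ((2 * d + 1 : ℕ) : ℕ∞) ≤ G.egirth) (v : V) {j : ℕ} (hj : j < d) :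
    #(sphere G (j + 1) v) = k * (k - 1) ^ j := by
  induction j with
  | zero =>
    rw [pow_zero, mul_one, ← hk v]
    congr 1
    ext y
    simp [mem_sphere]
  | succ j ih =>
    -- Double count the edges between consecutive spheres: `k - 1` per vertex from below, one per
    -- vertex from above.
    have h1 : ∑ y ∈ sphere G (j + 1) v, #{b ∈ sphere G (j + 2) v | G.Adj y b} =
        ∑ b ∈ sphere G (j + 2) v, #{y ∈ sphere G (j + 1) v | G.Adj y b} :=
      Finset.sum_card_bipartiteAbove_eq_sum_card_bipartiteBelow _
    rw [Finset.sum_congr rfl (g := fun _ => k - 1),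
      Finset.sum_congr (s₁ := sphere G (j + 2) v) rfl (g := fun _ => 1),
      Finset.sum_const, Finset.sum_const, ih (by omega), smul_eq_mul, smul_eq_mul, mul_one] at h1
    · rw [← h1, pow_succ, mul_assoc]
    · intro b hb
      simp only [G.adj_comm _ b]
      exact card_neighbors_sphere_pred hG hj (mem_sphere.1 hb)
    · intro y hy
      have h2 := card_neighbors_add hk (mem_sphere.1 hy)
      rw [card_neighbors_sphere_pred hG (by omega) (mem_sphere.1 hy)] at h2
      have h3 : #{b ∈ sphere G (j + 1) v | G.Adj y b} = 0 := by
        rw [Finset.card_eq_zero, Finset.filter_eq_empty_iff]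
        intro b hb
        exact not_adj_of_edist_eq hG hj (mem_sphere.1 hy) (mem_sphere.1 hb)
      omega

open scoped Classical in
theorem card_closedBall_eq (hk : ∀ v, #{b | G.Adj v b} = k)
    (hG : ((2 * d + 1 : ℕ) : ℕ∞) ≤ G.egirth) (v w : V) {j : ℕ} (hj : j ≤ d) :
    #(closedBall G j v) = #(closedBall G j w) := by
  induction j with
  | zero =>
    have : ∀ v, closedBall G 0 v = {v} := fun v => by
      ext y; simp [mem_closedBall, eq_comm (a := v)]
    rw [this, this, Finset.card_singleton, Finset.card_singleton]
  | succ j ih =>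
    have : ∀ v, #(closedBall G (j + 1) v) = #(closedBall G j v) + #(sphere G (j + 1) v) := by
      intro v
      rw [← Finset.card_union_of_disjoint]
      · congr 1
        ext y
        simp only [Finset.mem_union, mem_closedBall, mem_sphere]
        rw [le_iff_lt_or_eq, Nat.cast_add_one, ENat.lt_add_one_iff (ENat.natCast_ne_top j)]
      · rw [Finset.disjoint_left]
        intro y h1 h2
        rw [mem_closedBall] at h1
        rw [mem_sphere] at h2
        rw [h2] at h1
        norm_cast at h1
        omega
    rw [this, this, ih (by omega), card_sphere hk hG v hj, card_sphere hk hG w hj]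

open scoped Classical in
theorem boundaryCard_closedBall (v : V) (j : ℕ) :
    boundaryCard G (closedBall G (j + 1) v) =
      ∑ a ∈ sphere G (j + 1) v, #{b ∈ sphere G (j + 2) v | G.Adj a b} := by
  have hsub : sphere G (j + 1) v ⊆ closedBall G (j + 1) v := fun a ha =>
    mem_closedBall.2 (mem_sphere.1 ha).le
  rw [boundaryCard, ← Finset.sum_subset hsub]
  · refine Finset.sum_congr rfl fun a ha => ?_
    congr 1
    ext b
    simp only [Finset.mem_filter, Finset.mem_univ, true_and, mem_closedBall, mem_sphere]
    rw [and_comm]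
    refine and_congr_left fun hab => ?_
    rcases edist_of_adj (mem_sphere.1 ha) hab with h | h | h <;> rw [h] <;> norm_cast <;> omega
  · intro a ha ha'
    rw [mem_closedBall] at ha
    rw [mem_sphere] at ha'
    rw [Finset.card_eq_zero, Finset.filter_eq_empty_iff]
    rintro b - ⟨hab, hb⟩
    rw [mem_closedBall] at hb
    have h1 := lt_of_le_of_ne ha ha'
    exact hb ((edist_le_add_one_of_adj v hab).trans (Order.add_one_le_of_lt h1))

open scoped Classical in
/-- Counting the edges at the sphere of radius `d` by the level of their other end. -/
theorem two_mul_ncard_add_boundaryCard (hk : ∀ v, #{b | G.Adj v b} = k)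
    (hd : 0 < d) (hG : ((2 * d + 1 : ℕ) : ℕ∞) ≤ G.egirth) (v : V) :
    2 * (sphereGraph G d v).edgeSet.ncard + boundaryCard G (closedBall G d v) =
      k * (k - 1) ^ d := by
  obtain ⟨j, rfl⟩ : ∃ j, d = j + 1 := ⟨d - 1, by omega⟩
  have h1 : 2 * (sphereGraph G (j + 1) v).edgeSet.ncard =
      ∑ a ∈ sphere G (j + 1) v, #{b ∈ sphere G (j + 1) v | G.Adj a b} := by
    rw [← coe_edgeFinset, Set.ncard_coe_finset, ← sum_degrees_eq_twice_card_edges]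
    symm
    refine Finset.sum_subset_zero_on_sdiff (Finset.subset_univ _) (fun a ha => ?_) fun a ha => ?_
    · rw [← card_neighborFinset_eq_degree, Finset.card_eq_zero, Finset.eq_empty_iff_forall_notMem]
      intro b hb
      rw [mem_neighborFinset] at hb
      exact (Finset.mem_sdiff.1 ha).2 (mem_sphere.2 hb.2.1)
    · rw [← card_neighborFinset_eq_degree]
      congr 1
      ext b
      rw [mem_neighborFinset, Finset.mem_filter, mem_sphere]
      exact ⟨fun h => ⟨h.2, mem_sphere.1 ha, h.1⟩, fun h => ⟨h.2.2, h.1⟩⟩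
  rw [h1, boundaryCard_closedBall, ← Finset.sum_add_distrib,
    Finset.sum_congr rfl (g := fun _ => k - 1), Finset.sum_const,
    card_sphere hk hG v (Nat.lt_succ_self j), smul_eq_mul, pow_succ, mul_assoc]
  intro a ha
  have h2 := card_neighbors_add hk (mem_sphere.1 ha)
  rw [card_neighbors_sphere_pred hG (Nat.lt_succ_self j) (mem_sphere.1 ha)] at h2
  omega

open scoped Classical in
/-- If an edge leaves the ball of radius `d` around `x`, then for some vertex `y` at least `2 * k`
edges leave the balls of radius `d` around `x` and `y` together. -/
theorem exists_le_two_mul_boundaryCard (hk : ∀ v, #{b | G.Adj v b} = k)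
    (hd : 0 < d) (hG : ((2 * d + 1 : ℕ) : ℕ∞) ≤ G.egirth) {x : V}
    (hx : 0 < boundaryCard G (closedBall G d x)) :
    ∃ y, 2 * k ≤ boundaryCard G (closedBall G d x) + boundaryCard G (closedBall G d y) := by
  obtain ⟨j, rfl⟩ : ∃ j, d = j + 1 := ⟨d - 1, by omega⟩
  -- A vertex in the first ball only is at distance exactly `d` from `x`; its parent is one step
  -- closer to `x`, so it also lies in the ball around `y`.
  have hne : ∀ {x y : V}, G.Adj x y → ∀ z ∈ closedBall G (j + 1) x \ closedBall G (j + 1) y,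
      ∃ b, G.Adj z b ∧ b ∉ closedBall G (j + 1) x \ closedBall G (j + 1) y := by
    intro x y hxy z hz
    rw [Finset.mem_sdiff, mem_closedBall, mem_closedBall] at hz
    have hyx : ∀ u, G.edist x u ≤ j → G.edist y u ≤ (j + 1 : ℕ) := fun u hu => by
      rw [edist_comm]
      refine (edist_le_add_one_of_adj u hxy).trans ?_
      rw [edist_comm, Nat.cast_add_one]
      gcongr
    have hz' : G.edist x z = (j + 1 : ℕ) := by
      refine hz.1.antisymm ?_
      by_contra hlt
      rw [not_le, Nat.cast_add_one, ENat.lt_add_one_iff (ENat.natCast_ne_top j)] at hlt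
      exact hz.2 (hyx z hlt)
    obtain ⟨b, hzb, hb⟩ := exists_parent hz'
    refine ⟨b, hzb, fun hmem => (Finset.mem_sdiff.1 hmem).2 (mem_closedBall.2 (hyx b hb.le))⟩
  rw [boundaryCard_closedBall] at hx
  obtain ⟨a, ha, ha'⟩ := Finset.exists_ne_zero_of_sum_ne_zero hx.ne'
  obtain ⟨w, hw⟩ := Finset.card_pos.1 (Nat.pos_of_ne_zero ha')
  have hxw := mem_sphere.1 (Finset.mem_filter.1 hw).1
  obtain ⟨p, hp⟩ := exists_walk_of_edist_eq_coe hxw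
  -- Take for `y` the second vertex of a geodesic from `x` to `w`, so that `w` is within `d` of `y`
  -- but not of `x`.
  cases p with
  | nil => simp at hp
  | @cons _ y _ hxy q =>
    rw [Walk.length_cons] at hp
    have hw1 : w ∈ closedBall G (j + 1) y \ closedBall G (j + 1) x := by
      rw [Finset.mem_sdiff, mem_closedBall, mem_closedBall, hxw]
      refine ⟨q.edist_le.trans (by exact_mod_cast (by omega)), ?_⟩
      norm_cast
      omega
    -- Balls of equal size: one difference being nonempty makes the other nonempty.
    have hcard := card_closedBall_eq hk hG x y le_rfl
    have hne2 : (closedBall G (j + 1) x \ closedBall G (j + 1) y).Nonempty := by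
      rw [← Finset.card_pos, Finset.card_sdiff_comm hcard]
      exact Finset.card_pos.2 ⟨w, hw1⟩
    refine ⟨y, ?_⟩
    have h1 := le_boundaryCard hk hne2 (hne hxy)
    have h2 := le_boundaryCard hk ⟨w, hw1⟩ (hne hxy.symm)
    have h3 := boundaryCard_sdiff_add_le (G := G) (closedBall G (j + 1) x) (closedBall G (j + 1) y)
    omega

end Layers

end VertexGirthRegular

theorem mainTheorem2 (k g ε : ℕ) (hk : 3 ≤ k) (hg : 3 ≤ g) (hg_odd : Odd g)
    (hε_pos : 0 < ε) (hε_le : (ε : ℚ) ≤ ((k : ℚ) - 1) / 2)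
    (n lam : ℕ) (hlam : (lam : ℚ) = (k : ℚ) * ((k : ℚ) - 1) ^ (g / 2) / 2 - (ε : ℚ))
    {V : Type*} [Fintype V] (G : SimpleGraph V) [DecidableRel G.Adj] :
    ¬ VertexGirthRegular.IsVGR G n k g lam := by
  rintro ⟨-, hreg, hgirth, hcyc⟩
  classical
  have hreg' : ∀ v, (@Finset.filter V (G.Adj v) (fun _ => Classical.propDecidable _)
      Finset.univ).card = k := fun v => by
    rw [← hreg v, ← G.card_neighborFinset_eq_degree]
    congr 1
    ext b
    simp
  obtain ⟨d, rfl⟩ := hg_odd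
  have hd : 0 < d := by omega
  rw [show (2 * d + 1) / 2 = d by omega] at hlam
  have hlam' : 2 * lam + 2 * ε = k * (k - 1) ^ d := by
    have : ((2 * lam + 2 * ε : ℕ) : ℚ) = ((k * (k - 1) ^ d : ℕ) : ℚ) := by
      push_cast [Nat.cast_sub (show 1 ≤ k by omega)]
      rw [hlam]; ring
    exact_mod_cast this
  have hε : 2 * ε + 1 ≤ k := by
    have : ((2 * ε + 1 : ℕ) : ℚ) ≤ k := by push_cast; linarith
    exact_mod_cast this
  have hb : ∀ v, VertexGirthRegular.boundaryCard G (VertexGirthRegular.closedBall G d v) =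
      2 * ε := by
    intro v
    have h1 := VertexGirthRegular.two_mul_ncard_add_boundaryCard hreg' hd hgirth.ge v
    rw [← VertexGirthRegular.ncard_cyclesThrough hgirth.ge hd v, hcyc v] at h1
    omega
  -- An empty graph has infinite girth.
  obtain ⟨x⟩ : Nonempty V := by
    by_contra hV
    rw [not_nonempty_iff] at hV
    have : G.egirth = ⊤ := SimpleGraph.egirth_eq_top.2 fun v => hV.elim v
    rw [this] at hgirth
    exact ENat.top_ne_natCast _ hgirth
  obtain ⟨y, hy⟩ := VertexGirthRegular.exists_le_two_mul_boundaryCard hreg' hd hgirth.ge (x := x)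
    (by rw [hb]; omega)
  rw [hb, hb] at hy
  omega
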